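/- Let $\Delta'\subset(\mathbb P^1)^5$ be the set of $5$-tuples $(\lambda_1,\dots,\lambda_5)$ of points of $\mathbb P^1=\mathbb P^1(\mathbb C)$ such that $\lambda_i=\lambda_j=\lambda_k$ for some three distinct indices $i,j,k$, and let $$X(2,5)=\bigl((\mathbb P^1)^5-\Delta'\bigr)/\mathrm{PGL}_2(\mathbb C)$$ be the quotient by the diagonal action, with its quotient structure: the quotient topology, and as functions on an open set those whose pull-back to $(\mathbb P^1)^5-\Delta'$ is regular (respectively holomorphic), according to whether it is regarded as an algebraic variety with the Zariski topology or as a complex analytic space with the Euclidean topology. This is the compactification of the configuration space of five distinct ordered points of $\mathbb P^1$. Write $\lambda_i=[a_i:b_i]$ and $d(ij)=a_jb_i-a_ib_j$ (which stands for the difference $\lambda_i-\lambda_j$, where $\lambda_i=b_i/a_i$), and for an ordering $(i,j,k,l,m)$ of $\{1,2,3,4,5\}$ put $$J(ijklm)(\lambda)=d(ij)\,d(jk)\,d(kl)\,d(lm)\,d(mi).$$ Up to sign, this depends only on the pentagon with vertices $i,j,k,l,m$ in this cyclic order, that is, on its set of edges $\{ij,jk,kl,lm,mi\}$; there are twelve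 pentagons. Choose, for each of the twelve pentagons, an ordering $(ijklm)$ that represents it, and list the twelve in any order. Then the twelve products $J(ijklm)$ have no common zero on $(\mathbb P^1)^5-\Delta'$, and $$J: X(2,5)\longrightarrow\mathbb P^{11},\qquad J(\lambda)=[\cdots:J(ijklm)(\lambda):\cdots]$$ is a well-defined map and a closed embedding, both of algebraic varieties (for the Zariski topologies and regular functions) and of complex analytic spaces (for the Euclidean topologies and holomorphic functions). That is, in each of the two settings, $J$ is a homeomorphism onto a closed subset of $\mathbb P^{11}$, functions (regular, respectively holomorphic) on open subsets of $\mathbb P^{11}$ pull back to such functions on $X(2,5)$, and every such function on an open subset of $X(2,5)$ is, locally around each point, the pull-back along $J$ of such a function on an open subset of $\mathbb P^{11}$. -/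

import Mathlib

open scoped LinearAlgebra.Projectivization MatrixGroups

/-- A space with functions: a topological space with a sheaf of `ℂ`-algebras of `ℂ`-valued
functions. For `U` open, `Reg U f` says that the restriction of `f` to `U` is a section of the
sheaf over `U` (the values of `f` outside `U` are irrelevant). -/
structure SpaceWithFunctions (X : Type) extends TopologicalSpace X where
  Reg : Set X → (X → ℂ) → Prop
  reg_congr : ∀ {U : Set X} {f g : X → ℂ}, IsOpen U → Set.EqOn f g U → Reg U f → Reg U g
  reg_mono : ∀ {U V : Set X} {f : X → ℂ}, IsOpen U → IsOpen V → V ⊆ U → Reg U f → Reg V f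
  reg_local : ∀ {U : Set X} {f : X → ℂ}, IsOpen U →
    (∀ x ∈ U, ∃ V : Set X, IsOpen V ∧ x ∈ V ∧ Reg V f) → Reg U f
  reg_const : ∀ {U : Set X} (c : ℂ), IsOpen U → Reg U (fun _ => c)
  reg_add : ∀ {U : Set X} {f g : X → ℂ}, IsOpen U → Reg U f → Reg U g → Reg U (fun x => f x + g x)
  reg_mul : ∀ {U : Set X} {f g : X → ℂ}, IsOpen U → Reg U f → Reg U g → Reg U (fun x => f x * g x)

namespace SpaceWithFunctions

/-- The affine space `ℂ^σ` as a complex manifold: the Euclidean topology and the sheaf of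
holomorphic functions. -/
noncomputable def holomorphicAffine (σ : Type) [Fintype σ] : SpaceWithFunctions (σ → ℂ) where
  toTopologicalSpace := inferInstance
  Reg U f := ∀ x ∈ U, AnalyticAt ℂ f x
  reg_congr hU h hf x hx :=
    (hf x hx).congr (Filter.eventuallyEq_of_mem (IsOpen.mem_nhds hU hx) h)
  reg_mono _ _ h hf x hx := hf x (h hx)
  reg_local _ h x hx := by
    obtain ⟨V, _, hxV, hV⟩ := h x hx
    exact hV x hxV
  reg_const _ _ _ _ := analyticAt_const
  reg_add _ hf hg x hx := (hf x hx).add (hg x hx)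
  reg_mul _ hf hg x hx := (hf x hx).mul (hg x hx)

/-- The Zariski topology on `ℂ^σ`: a set is open if it is a union of principal open sets
`{p ≠ 0}`, with `p` a polynomial. -/
@[reducible] def zariskiTopology (σ : Type) : TopologicalSpace (σ → ℂ) where
  IsOpen U := ∀ x ∈ U, ∃ p : MvPolynomial σ ℂ,
    MvPolynomial.eval x p ≠ 0 ∧ ∀ y, MvPolynomial.eval y p ≠ 0 → y ∈ U
  isOpen_univ _ _ := ⟨1, by simp, fun _ _ => Set.mem_univ _⟩
  isOpen_inter U V hU hV x hx := by
    obtain ⟨p, hp, hpU⟩ := hU x hx.1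
    obtain ⟨q, hq, hqV⟩ := hV x hx.2
    refine ⟨p * q, by simpa using ⟨hp, hq⟩, fun y hy => ?_⟩
    rw [map_mul] at hy
    exact ⟨hpU y (left_ne_zero_of_mul hy), hqV y (right_ne_zero_of_mul hy)⟩
  isOpen_sUnion S hS x hx := by
    obtain ⟨U, hU, hxU⟩ := hx
    obtain ⟨p, hp, hpU⟩ := hS U hU x hxU
    exact ⟨p, hp, fun y hy => ⟨U, hU, hpU y hy⟩⟩

/-- The affine space `ℂ^σ` as an algebraic variety: the Zariski topology and the sheaf of regular
functions, i.e. of the functions that are locally quotients of polynomials. -/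
noncomputable def algebraicAffine (σ : Type) : SpaceWithFunctions (σ → ℂ) where
  toTopologicalSpace := zariskiTopology σ
  Reg U f := ∀ x ∈ U, ∃ V : Set (σ → ℂ), (zariskiTopology σ).IsOpen V ∧ x ∈ V ∧
    ∃ p q : MvPolynomial σ ℂ, ∀ y ∈ V ∩ U, MvPolynomial.eval y q ≠ 0 ∧
      f y = MvPolynomial.eval y p / MvPolynomial.eval y q
  reg_congr _ h hf x hx := by
    obtain ⟨V, hV, hxV, p, q, hpq⟩ := hf x hx
    exact ⟨V, hV, hxV, p, q, fun y hy => ⟨(hpq y hy).1, (h hy.2).symm.trans (hpq y hy).2⟩⟩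
  reg_mono _ _ h hf x hx := by
    obtain ⟨V, hV, hxV, p, q, hpq⟩ := hf x (h hx)
    exact ⟨V, hV, hxV, p, q, fun y hy => hpq y ⟨hy.1, h hy.2⟩⟩
  reg_local _ h x hx := by
    obtain ⟨W, hW, hxW, hf⟩ := h x hx
    obtain ⟨V, hV, hxV, p, q, hpq⟩ := hf x hxW
    exact ⟨V ∩ W, (zariskiTopology σ).isOpen_inter V W hV hW, ⟨hxV, hxW⟩, p, q,
      fun y hy => hpq y hy.1⟩
  reg_const c _ x _ :=
    ⟨Set.univ, (zariskiTopology σ).isOpen_univ, Set.mem_univ _, MvPolynomial.C c, 1, by simp⟩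
  reg_add _ hf hg x hx := by
    obtain ⟨V, hV, hxV, p, q, hpq⟩ := hf x hx
    obtain ⟨V', hV', hxV', p', q', hpq'⟩ := hg x hx
    refine ⟨V ∩ V', (zariskiTopology σ).isOpen_inter V V' hV hV', ⟨hxV, hxV'⟩,
      p * q' + q * p', q * q', fun y hy => ?_⟩
    obtain ⟨h1, h2⟩ := hpq y ⟨hy.1.1, hy.2⟩
    obtain ⟨h3, h4⟩ := hpq' y ⟨hy.1.2, hy.2⟩
    refine ⟨by simpa using ⟨h1, h3⟩, ?_⟩
    simp only [h2, h4, map_add, map_mul]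
    exact div_add_div _ _ h1 h3
  reg_mul _ hf hg x hx := by
    obtain ⟨V, hV, hxV, p, q, hpq⟩ := hf x hx
    obtain ⟨V', hV', hxV', p', q', hpq'⟩ := hg x hx
    refine ⟨V ∩ V', (zariskiTopology σ).isOpen_inter V V' hV hV', ⟨hxV, hxV'⟩,
      p * p', q * q', fun y hy => ?_⟩
    obtain ⟨h1, h2⟩ := hpq y ⟨hy.1.1, hy.2⟩
    obtain ⟨h3, h4⟩ := hpq' y ⟨hy.1.2, hy.2⟩
    refine ⟨by simpa using ⟨h1, h3⟩, ?_⟩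
    simp only [h2, h4, map_mul]
    exact div_mul_div_comm _ _ _ _

/-- The structure induced on a subset `S`: the subspace topology, and the functions that locally
extend to sections on the ambient space. (It is used for open `S` only.) -/
def restrict {X : Type} (A : SpaceWithFunctions X) (S : Set X) : SpaceWithFunctions S where
  toTopologicalSpace := A.toTopologicalSpace.induced Subtype.val
  Reg U f := ∀ x ∈ U, ∃ (N : Set X) (g : X → ℂ), A.IsOpen N ∧ (x : X) ∈ N ∧ A.Reg N g ∧
    ∀ y ∈ U, (y : X) ∈ N → f y = g y
  reg_congr _ h hf x hx := by
    obtain ⟨N, g, hN, hxN, hg, hfg⟩ := hf x hx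
    exact ⟨N, g, hN, hxN, hg, fun y hy hyN => (h hy).symm.trans (hfg y hy hyN)⟩
  reg_mono _ _ h hf x hx := by
    obtain ⟨N, g, hN, hxN, hg, hfg⟩ := hf x (h hx)
    exact ⟨N, g, hN, hxN, hg, fun y hy hyN => hfg y (h hy) hyN⟩
  reg_local _ h x hx := by
    obtain ⟨V, ⟨W, hW, rfl⟩, hxV, hf⟩ := h x hx
    obtain ⟨N, g, hN, hxN, hg, hfg⟩ := hf x hxV
    have hNW : A.IsOpen (N ∩ W) := A.isOpen_inter N W hN hW
    exact ⟨N ∩ W, g, hNW, ⟨hxN, hxV⟩, A.reg_mono hN hNW Set.inter_subset_left hg,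
      fun y _ hyN => hfg y hyN.2 hyN.1⟩
  reg_const c _ x _ :=
    ⟨Set.univ, fun _ => c, A.isOpen_univ, Set.mem_univ _, A.reg_const c A.isOpen_univ,
      fun _ _ _ => rfl⟩
  reg_add _ hf hg x hx := by
    obtain ⟨N, f', hN, hxN, hf', hff'⟩ := hf x hx
    obtain ⟨M, g', hM, hxM, hg', hgg'⟩ := hg x hx
    have hNM : A.IsOpen (N ∩ M) := A.isOpen_inter N M hN hM
    exact ⟨N ∩ M, fun y => f' y + g' y, hNM, ⟨hxN, hxM⟩,
      A.reg_add hNM (A.reg_mono hN hNM Set.inter_subset_left hf')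
        (A.reg_mono hM hNM Set.inter_subset_right hg'),
      fun y hy hyN => congrArg₂ (· + ·) (hff' y hy hyN.1) (hgg' y hy hyN.2)⟩
  reg_mul _ hf hg x hx := by
    obtain ⟨N, f', hN, hxN, hf', hff'⟩ := hf x hx
    obtain ⟨M, g', hM, hxM, hg', hgg'⟩ := hg x hx
    have hNM : A.IsOpen (N ∩ M) := A.isOpen_inter N M hN hM
    exact ⟨N ∩ M, fun y => f' y * g' y, hNM, ⟨hxN, hxM⟩,
      A.reg_mul hNM (A.reg_mono hN hNM Set.inter_subset_left hf')
        (A.reg_mono hM hNM Set.inter_subset_right hg'),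
      fun y hy hyN => congrArg₂ (· * ·) (hff' y hy hyN.1) (hgg' y hy hyN.2)⟩

/-- The quotient structure along a map `π` (the geometric quotient, when `π` is a quotient map by
a group): the quotient topology, and the functions whose pull-back along `π` is a section. -/
def quotient {X Y : Type} (A : SpaceWithFunctions X) (π : X → Y) : SpaceWithFunctions Y where
  toTopologicalSpace := A.toTopologicalSpace.coinduced π
  Reg U f := A.Reg (π ⁻¹' U) (f ∘ π)
  reg_congr hU h hf := A.reg_congr hU (fun _ hx => h hx) hf
  reg_mono hU hV h hf := A.reg_mono hU hV (Set.preimage_mono h) hf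
  reg_local hU h := A.reg_local hU fun x hx => by
    obtain ⟨V, hV, hxV, hf⟩ := h (π x) hx
    exact ⟨π ⁻¹' V, hV, hxV, hf⟩
  reg_const c hU := A.reg_const c hU
  reg_add hU hf hg := A.reg_add hU hf hg
  reg_mul hU hf hg := A.reg_mul hU hf hg

/-- `φ` is a closed embedding, i.e. an isomorphism onto a closed subspace: it is a homeomorphism
onto a closed subset, it is a morphism (sections pull back to sections), and every section on the
source is, locally, the pull-back of a section on the target. -/
structure IsClosedEmbedding {X Y : Type} (A : SpaceWithFunctions X) (B : SpaceWithFunctions Y)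
    (φ : X → Y) : Prop where
  isClosedEmbedding :
    @Topology.IsClosedEmbedding X Y A.toTopologicalSpace B.toTopologicalSpace φ
  pullback : ∀ (V : Set Y) (g : Y → ℂ), B.IsOpen V → B.Reg V g → A.Reg (φ ⁻¹' V) (g ∘ φ)
  surjective : ∀ (U : Set X) (f : X → ℂ), A.IsOpen U → A.Reg U f → ∀ x ∈ U,
    ∃ (V : Set Y) (g : Y → ℂ), B.IsOpen V ∧ φ x ∈ V ∧ φ ⁻¹' V ⊆ U ∧ B.Reg V g ∧
      ∀ y ∈ φ ⁻¹' V, f y = g (φ y)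

/-- The projective space of lines in `ℂ^n`, with the structure coming from a structure on the
affine space `ℂ^n`. -/
noncomputable def projectiveSpace (n : ℕ) (A : SpaceWithFunctions (Fin n → ℂ)) :
    SpaceWithFunctions (ℙ ℂ (Fin n → ℂ)) :=
  (A.restrict {v | v ≠ 0}).quotient fun v => Projectivization.mk ℂ v.1 v.2

end SpaceWithFunctions

/-- The complex projective line. -/
abbrev ProjLine : Type := ℙ ℂ (Fin 2 → ℂ)

/-- The five points of the projective line with homogeneous coordinates
`[w (i, 0) : w (i, 1)]`. -/
noncomputable def fivePoints (w : {w : Fin 5 × Fin 2 → ℂ | ∀ i, (fun a => w (i, a)) ≠ 0}) :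
    Fin 5 → ProjLine :=
  fun i => Projectivization.mk ℂ (fun a => w.1 (i, a)) (w.2 i)

/-- The degenerate locus `Δ'`: three of the five points coincide. -/
def tripleLocus : Set (Fin 5 → ProjLine) :=
  {l | ∃ i j k : Fin 5, i ≠ j ∧ j ≠ k ∧ i ≠ k ∧ l i = l j ∧ l j = l k}

/-- The diagonal action of `PGL₂(ℂ)` on `(ℙ¹)⁵ - Δ'`: two configurations are equivalent if they
lie in the same orbit. -/
noncomputable def configSetoid : Setoid ↥(tripleLocusᶜ) :=
  (MulAction.orbitRel PGL(2, ℂ) (Fin 5 → ProjLine)).comap Subtype.val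

/-- The compactified configuration space `X(2,5) = ((ℙ¹)⁵ - Δ') / PGL₂(ℂ)`. -/
def ConfigSpace : Type := Quotient configSetoid

/-- The class in `X(2,5)` of a configuration of five points. -/
noncomputable def ConfigSpace.mk (l : ↥(tripleLocusᶜ)) : ConfigSpace := Quotient.mk configSetoid l

/-- The structure on `X(2,5)` coming from a structure on the affine space `ℂ^10` of homogeneous
coordinates: quotient of the open subspace `(ℙ¹)⁵ - Δ'` of `(ℙ¹)⁵`, itself the quotient of
`(ℂ² - 0)⁵`. -/
noncomputable def configStructure (A : SpaceWithFunctions (Fin 5 × Fin 2 → ℂ)) :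
    SpaceWithFunctions ConfigSpace :=
  (((A.restrict {w | ∀ i, (fun a => w (i, a)) ≠ 0}).quotient fivePoints).restrict
    tripleLocusᶜ).quotient ConfigSpace.mk

/-- `d(ij) = a_j b_i - a_i b_j`, where the `i`-th point is `[a_i : b_i]`; it stands for the
difference `λ_i - λ_j`, where `λ_i = b_i / a_i`. -/
noncomputable def pointDiff (w : Fin 5 × Fin 2 → ℂ) (i j : Fin 5) : ℂ :=
  w (j, 0) * w (i, 1) - w (i, 0) * w (j, 1)

/-- The pentagon with vertices `p 0, p 1, p 2, p 3, p 4` in this cyclic order, as its set of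
(unoriented) edges. -/
def pentagonEdges (p : Equiv.Perm (Fin 5)) : Finset (Sym2 (Fin 5)) :=
  Finset.univ.image fun t => s(p t, p (t + 1))

/-- The pentagon product `J(ijklm) = d(ij) d(jk) d(kl) d(lm) d(mi)`, where
`(i, j, k, l, m) = (p 0, p 1, p 2, p 3, p 4)`. -/
noncomputable def pentagonProduct (p : Equiv.Perm (Fin 5)) (w : Fin 5 × Fin 2 → ℂ) : ℂ :=
  pointDiff w (p 0) (p 1) * pointDiff w (p 1) (p 2) * pointDiff w (p 2) (p 3) *
    pointDiff w (p 3) (p 4) * pointDiff w (p 4) (p 0)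

/-! A product J(p) is nonzero exactly when consecutive points along the pentagon p are distinct.
Among any three vertices of a pentagon two are adjacent, so J(p) ≠ 0 excludes triple coincidences;
conversely, without triple coincidences some J(p) is nonzero. Hence the loci J(p) ≠ 0 cover X(2,5).

On such a locus the matrix action and the rescalings of the five vectors normalise every
configuration to a closed Coxeter frieze: d(01) = d(12) = d(23) = d(34) = d(04) = 1 along p. It is
determined by three numbers a, b, c with abc - a - c = 1. By the Plücker relation each of them
equals -J(q)/J(p) - 1, where q arises from p by exchanging two neighbouring vertices. So a, b, c are
regular functions of the image point, which gives a regular inverse on the chart. Since J(p) = -1 on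
a closed frieze, the image in the chart z_p ≠ 0 is cut out by the equations z_k = -z_p
J_k(frieze(z)), hence is closed.

The argument uses only a few properties common to regular and holomorphic functions
(`IsAffineGeometry`). It is carried out in homogeneous coordinates, through `Presents`, by the
criterion `IsAffineGeometry.isClosedEmbedding`; the explicit inverse is `frieze_pentagonRatio`. -/

namespace SpaceWithFunctions

/-! ### Presentations of spaces with functions by coordinates -/

/-- A presentation of the space with functions `B` by the space with functions `A`: a relation
`R w x`, to be read as "`w` is a system of coordinates of the point `x`", such that the open sets
and the sections of `B` are those that are open sets and sections in coordinates. -/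
structure Presents {E X : Type} (A : SpaceWithFunctions E) (R : E → X → Prop)
    (B : SpaceWithFunctions X) : Prop where
  unique : ∀ {w x y}, R w x → R w y → x = y
  surj : ∀ x, ∃ w, R w x
  isOpen_iff : ∀ U : Set X, B.IsOpen U ↔ A.IsOpen {w | ∃ x ∈ U, R w x}
  reg_iff : ∀ (U : Set X) (f : X → ℂ) (F : E → ℂ), B.IsOpen U →
    (∀ w x, x ∈ U → R w x → F w = f x) → (B.Reg U f ↔ A.Reg {w | ∃ x ∈ U, R w x} F)

theorem presents_restrict {X : Type} (A : SpaceWithFunctions X) {S : Set X} (hS : A.IsOpen S) :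
    Presents A (fun w (x : S) => w = x) (A.restrict S) where
  unique h h' := Subtype.ext (h.symm.trans h')
  surj x := ⟨x, rfl⟩
  isOpen_iff U := by
    constructor
    · rintro ⟨W, hW, rfl⟩
      convert A.isOpen_inter W S hW hS using 1
      ext w
      constructor
      · rintro ⟨x, hx, rfl⟩
        exact ⟨hx, x.2⟩
      · rintro ⟨hw, hwS⟩
        exact ⟨⟨w, hwS⟩, hw, rfl⟩
    · intro h
      refine ⟨_, h, ?_⟩
      ext x
      constructor
      · rintro ⟨y, hy, hxy⟩
        rwa [Subtype.ext hxy]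
      · exact fun hx => ⟨x, hx, rfl⟩
  reg_iff U f F hU hF := by
    have hU' : A.IsOpen {w | ∃ x ∈ U, w = (x : X)} := by
      obtain ⟨W, hW, rfl⟩ := hU
      convert A.isOpen_inter W S hW hS using 1
      ext w
      constructor
      · rintro ⟨x, hx, rfl⟩
        exact ⟨hx, x.2⟩
      · rintro ⟨hw, hwS⟩
        exact ⟨⟨w, hwS⟩, hw, rfl⟩
    constructor
    · intro h
      refine A.reg_local hU' ?_
      rintro w ⟨x, hx, rfl⟩
      obtain ⟨N, g, hN, hxN, hg, hfg⟩ := h x hx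
      have hNU := A.isOpen_inter _ _ hN hU'
      refine ⟨_, hNU, ⟨hxN, x, hx, rfl⟩, A.reg_congr hNU ?_
        (A.reg_mono hN hNU Set.inter_subset_left hg)⟩
      rintro _ ⟨hyN, y, hy, rfl⟩
      rw [hF _ y hy rfl, hfg y hy hyN]
    · intro h x hx
      exact ⟨_, F, hU', ⟨x, hx, rfl⟩, h, fun y hy _ => (hF _ y hy rfl).symm⟩

theorem presents_quotient {X Y : Type} (A : SpaceWithFunctions X) {π : X → Y}
    (hπ : Function.Surjective π) : Presents A (fun x y => π x = y) (A.quotient π) where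
  unique h h' := h.symm.trans h'
  surj := hπ
  isOpen_iff U := by
    simp only [exists_eq_right']
    rfl
  reg_iff U f F hU hF := by
    have hU' : A.IsOpen (π ⁻¹' U) := hU
    have : {w | ∃ x ∈ U, π w = x} = π ⁻¹' U := by ext; simp
    rw [this]
    exact ⟨A.reg_congr hU' fun x hx => (hF x _ hx rfl).symm,
      A.reg_congr hU' fun x hx => hF x _ hx rfl⟩

open Classical in
/-- The function of the coordinates given by a function `f` of the points, extended by zero. -/
noncomputable def inCoordinates {E X : Type} (R : E → X → Prop) (f : X → ℂ) (w : E) : ℂ :=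
  if h : ∃ x, R w x then f h.choose else 0

namespace Presents

variable {E X Y : Type} {A : SpaceWithFunctions E} {R : E → X → Prop} {B : SpaceWithFunctions X}

theorem inCoordinates_eq (h : Presents A R B) (f : X → ℂ) {w : E} {x : X} (hw : R w x) :
    inCoordinates R f w = f x := by
  have hex : ∃ x, R w x := ⟨x, hw⟩
  rw [inCoordinates, dif_pos hex, h.unique hex.choose_spec hw]

theorem reg_iff_inCoordinates (h : Presents A R B) {U : Set X} (hU : B.IsOpen U) (f : X → ℂ) :
    B.Reg U f ↔ A.Reg {w | ∃ x ∈ U, R w x} (inCoordinates R f) :=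
  h.reg_iff U f _ hU fun _ _ _ hw => h.inCoordinates_eq f hw

theorem isOpen_dom (h : Presents A R B) : A.IsOpen {w | ∃ x, R w x} := by
  simpa using (h.isOpen_iff Set.univ).1 B.isOpen_univ

/-- Allows a tower of restrictions and quotients to be replaced by one relation on the affine space.
-/
theorem trans (h : Presents A R B) {R' : X → Y → Prop} {C : SpaceWithFunctions Y}
    (h' : Presents B R' C) : Presents A (fun w y => ∃ x, R w x ∧ R' x y) C := by
  have key (U : Set Y) : {w | ∃ x ∈ {x | ∃ y ∈ U, R' x y}, R w x} =
      {w | ∃ y ∈ U, ∃ x, R w x ∧ R' x y} := by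
    ext w
    constructor
    · rintro ⟨x, ⟨y, hy, hxy⟩, hwx⟩
      exact ⟨y, hy, x, hwx, hxy⟩
    · rintro ⟨y, hy, x, hwx, hxy⟩
      exact ⟨x, ⟨y, hy, hxy⟩, hwx⟩
  refine ⟨?_, ?_, ?_, ?_⟩
  · rintro w y z ⟨x, hx, hxy⟩ ⟨x', hx', hxz⟩
    obtain rfl := h.unique hx hx'
    exact h'.unique hxy hxz
  · intro y
    obtain ⟨x, hx⟩ := h'.surj y
    obtain ⟨w, hw⟩ := h.surj x
    exact ⟨w, x, hw, hx⟩
  · intro U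
    rw [h'.isOpen_iff, h.isOpen_iff, key]
  · intro U f F hU hF
    rw [h'.reg_iff_inCoordinates hU, h.reg_iff _ _ F ((h'.isOpen_iff U).1 hU), key]
    rintro w x ⟨y, hy, hxy⟩ hwx
    rw [h'.inCoordinates_eq f hxy, hF w y hy ⟨x, hwx, hxy⟩]

theorem congr (h : Presents A R B) {R' : E → X → Prop} (hR : ∀ w x, R w x ↔ R' w x) :
    Presents A R' B := by
  have : R = R' := by ext; exact hR _ _
  exact this ▸ h

end Presents

/-! ### Affine geometries and the embedding criterion -/

/-- A geometry of affine spaces: structures of space with functions on all the `ℂ^σ`, for which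
the maps with regular coordinates are morphisms. -/
structure IsAffineGeometry (A : ∀ (σ : Type) [Fintype σ], SpaceWithFunctions (σ → ℂ)) : Prop where
  coord : ∀ {σ : Type} [Fintype σ] (i : σ), (A σ).Reg Set.univ fun x => x i
  reg_inv : ∀ {σ : Type} [Fintype σ] {U : Set (σ → ℂ)} {f : (σ → ℂ) → ℂ}, (A σ).IsOpen U →
    (A σ).Reg U f → (∀ x ∈ U, f x ≠ 0) → (A σ).Reg U fun x => (f x)⁻¹
  isOpen_ne : ∀ {σ : Type} [Fintype σ] {U : Set (σ → ℂ)} {f : (σ → ℂ) → ℂ}, (A σ).IsOpen U →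
    (A σ).Reg U f → (A σ).IsOpen {x | x ∈ U ∧ f x ≠ 0}
  isOpen_preimage : ∀ {σ τ : Type} [Fintype σ] [Fintype τ] {U : Set (σ → ℂ)} {V : Set (τ → ℂ)}
    {φ : (σ → ℂ) → τ → ℂ}, (A σ).IsOpen U → (∀ i, (A σ).Reg U fun x => φ x i) →
    (A τ).IsOpen V → (A σ).IsOpen (U ∩ φ ⁻¹' V)
  reg_comp : ∀ {σ τ : Type} [Fintype σ] [Fintype τ] {U : Set (σ → ℂ)} {V : Set (τ → ℂ)}
    {φ : (σ → ℂ) → τ → ℂ} {g : (τ → ℂ) → ℂ}, (A σ).IsOpen U →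
    (∀ i, (A σ).Reg U fun x => φ x i) → (A τ).IsOpen V → (A τ).Reg V g →
    (A σ).Reg (U ∩ φ ⁻¹' V) (g ∘ φ)

/-- A map of presented spaces that is given by a regular map `P` in coordinates is a closed
embedding, if coordinates of a point can be recovered from coordinates of its image by regular
maps `ρ s` defined on an open cover, and the image is locally defined by regular equations. -/
theorem IsAffineGeometry.isClosedEmbedding
    {A : ∀ (σ : Type) [Fintype σ], SpaceWithFunctions (σ → ℂ)} (hA : IsAffineGeometry A)
    {σ τ X Y : Type} [Fintype σ] [Fintype τ]
    {R₁ : (σ → ℂ) → X → Prop} {B₁ : SpaceWithFunctions X} (h₁ : Presents (A σ) R₁ B₁)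
    {R₂ : (τ → ℂ) → Y → Prop} {B₂ : SpaceWithFunctions Y} (h₂ : Presents (A τ) R₂ B₂)
    {φ : X → Y} {P : (σ → ℂ) → τ → ℂ} (hP : ∀ i, (A σ).Reg Set.univ fun w => P w i)
    (hφ : ∀ {w x}, R₁ w x → R₂ (P w) (φ x))
    {ι : Type} {D : ι → Set (τ → ℂ)} (hD : ∀ s, (A τ).IsOpen (D s))
    {ρ : ι → (τ → ℂ) → σ → ℂ} (hρ : ∀ s i, (A τ).Reg (D s) fun z => ρ s z i)
    (hcover : ∀ {z y}, R₂ z y → ∃ s, z ∈ D s)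
    (hinv : ∀ {s z z' y}, R₂ z y → R₂ z' y → z ∈ D s → z' ∈ D s ∧ ρ s z = ρ s z')
    (hsec : ∀ {s w x}, R₁ w x → P w ∈ D s → R₁ (ρ s (P w)) x)
    {κ : Type} {e : ι → κ → (τ → ℂ) → ℂ} (he : ∀ s k, (A τ).Reg (D s) (e s k))
    (hrange : ∀ {s z y}, R₂ z y → z ∈ D s → (y ∈ Set.range φ ↔ ∀ k, e s k z = 0)) :
    IsClosedEmbedding B₁ B₂ φ := by
  have hpre (V : Set Y) : {w | ∃ x ∈ φ ⁻¹' V, R₁ w x} =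
      {w | ∃ x, R₁ w x} ∩ (Set.univ ∩ P ⁻¹' {z | ∃ y ∈ V, R₂ z y}) := by
    ext w
    constructor
    · rintro ⟨x, hx, hw⟩
      exact ⟨⟨x, hw⟩, trivial, φ x, hx, hφ hw⟩
    · rintro ⟨⟨x, hw⟩, -, y, hy, hwy⟩
      refine ⟨x, ?_, hw⟩
      rwa [Set.mem_preimage, h₂.unique (hφ hw) hwy]
  have hcont (V : Set Y) (hV : B₂.IsOpen V) : B₁.IsOpen (φ ⁻¹' V) := by
    rw [h₁.isOpen_iff, hpre]
    exact (A σ).isOpen_inter _ _ h₁.isOpen_dom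
      (hA.isOpen_preimage (A σ).isOpen_univ hP ((h₂.isOpen_iff V).1 hV))
  have hsurj (U : Set X) (f : X → ℂ) (hU : B₁.IsOpen U) (hf : B₁.Reg U f) (x : X) (hx : x ∈ U) :
      ∃ (V : Set Y) (g : Y → ℂ), B₂.IsOpen V ∧ φ x ∈ V ∧ φ ⁻¹' V ⊆ U ∧ B₂.Reg V g ∧
        ∀ y ∈ φ ⁻¹' V, f y = g (φ y) := by
    obtain ⟨w, hw⟩ := h₁.surj x
    obtain ⟨s, hs⟩ := hcover (hφ hw)
    -- The extension of `f` is `f` read through `ρ s`, and it also makes sense off the image. By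
    -- `hinv` neither `V` nor the extension depends on the coordinates chosen for `y`.
    let V : Set Y := {y | ∃ z ∈ D s, R₂ z y ∧ ∃ x ∈ U, R₁ (ρ s z) x}
    let N : Set (τ → ℂ) := D s ∩ ρ s ⁻¹' {w | ∃ x ∈ U, R₁ w x}
    have hVN : {z | ∃ y ∈ V, R₂ z y} = {z | ∃ y, R₂ z y} ∩ N := by
      ext z
      constructor
      · rintro ⟨y, ⟨z', hz', hy', x, hx, hzx⟩, hy⟩
        obtain ⟨hz, hzz⟩ := hinv hy' hy hz'
        exact ⟨⟨y, hy⟩, hz, x, hx, hzz ▸ hzx⟩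
      · rintro ⟨⟨y, hy⟩, hz, hx⟩
        exact ⟨y, ⟨z, hz, hy, hx⟩, hy⟩
    have hU' := (h₁.isOpen_iff U).1 hU
    have hN : (A τ).IsOpen N := hA.isOpen_preimage (hD s) (hρ s) hU'
    have hN' := (A τ).isOpen_inter _ _ h₂.isOpen_dom hN
    have hV : B₂.IsOpen V := by rwa [h₂.isOpen_iff, hVN]
    have hVU (x') (hx' : φ x' ∈ V) : ∃ w, R₁ w x' ∧ P w ∈ D s ∧ x' ∈ U := by
      obtain ⟨w', hw'⟩ := h₁.surj x'
      obtain ⟨z, hz, hzx, x'', hx'', hzx''⟩ := hx'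
      obtain ⟨hz', hzz⟩ := hinv hzx (hφ hw') hz
      refine ⟨w', hw', hz', ?_⟩
      rw [hzz] at hzx''
      rwa [h₁.unique (hsec hw' hz') hzx'']
    choose c hc using h₂.surj
    refine ⟨V, fun y => inCoordinates R₁ f (ρ s (c y)), hV,
      ⟨P w, hs, hφ hw, x, hx, hsec hw hs⟩, fun x' hx' => (hVU x' hx').choose_spec.2.2, ?_, ?_⟩
    · rw [h₂.reg_iff _ _ (inCoordinates R₁ f ∘ ρ s) hV, hVN]
      · exact (A τ).reg_mono hN hN' Set.inter_subset_right
          (hA.reg_comp (hD s) (hρ s) hU' ((h₁.reg_iff_inCoordinates hU f).1 hf))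
      · rintro z y ⟨z', hz', hy', -⟩ hy
        have hz := (hinv hy' hy hz').1
        exact congrArg (inCoordinates R₁ f) (hinv hy (hc y) hz).2
    · intro x' hx'
      obtain ⟨w', hw', hz', -⟩ := hVU x' hx'
      change f x' = inCoordinates R₁ f (ρ s (c (φ x')))
      rw [← (hinv (hφ hw') (hc _) hz').2, h₁.inCoordinates_eq f (hsec hw' hz')]
  refine ⟨?_, ?_, hsurj⟩
  · let _ := B₁.toTopologicalSpace
    let _ := B₂.toTopologicalSpace
    refine ⟨⟨⟨TopologicalSpace.ext_iff.2 fun U => ?_⟩, ?_⟩, ?_⟩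
    · constructor
      · intro hU
        -- Only the open sets supplied by `hsurj` matter here, so the zero section is enough.
        choose V g hV hxV hVU _ _ using fun x : U =>
          hsurj U (fun _ => 0) hU (B₁.reg_const 0 hU) x x.2
        refine ⟨⋃ x, V x, isOpen_iUnion hV, ?_⟩
        refine Set.Subset.antisymm ?_ fun x hx => Set.mem_iUnion.2 ⟨⟨x, hx⟩, hxV ⟨x, hx⟩⟩
        rw [Set.preimage_iUnion]
        exact Set.iUnion_subset hVU
      · rintro ⟨V, hV, rfl⟩
        exact hcont V hV
    · intro x x' hxx
      obtain ⟨w, hw⟩ := h₁.surj x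
      obtain ⟨w', hw'⟩ := h₁.surj x'
      obtain ⟨s, hs⟩ := hcover (hφ hw)
      have hw'' := hφ hw'
      rw [← hxx] at hw''
      obtain ⟨hs', heq⟩ := hinv (hφ hw) hw'' hs
      have := hsec hw hs
      rw [heq] at this
      exact h₁.unique this (hsec hw' hs')
    · refine ⟨?_⟩
      change B₂.IsOpen _
      have hset : {z | ∃ y ∈ (Set.range φ)ᶜ, R₂ z y} =
          ⋃ s, ⋃ k, {z | ∃ y, R₂ z y} ∩ {z | z ∈ D s ∧ e s k z ≠ 0} := by
        ext z
        simp only [Set.mem_iUnion]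
        constructor
        · rintro ⟨y, hy, hz⟩
          obtain ⟨s, hs⟩ := hcover hz
          rw [Set.mem_compl_iff, hrange hz hs, not_forall] at hy
          obtain ⟨k, hk⟩ := hy
          exact ⟨s, k, ⟨y, hz⟩, hs, hk⟩
        · rintro ⟨s, k, ⟨y, hz⟩, hs, hk⟩
          refine ⟨y, fun hy => hk ?_, hz⟩
          exact (hrange hz hs).1 hy k
      rw [h₂.isOpen_iff, hset]
      exact @isOpen_iUnion _ _ (A τ).toTopologicalSpace _ fun s =>
        @isOpen_iUnion _ _ (A τ).toTopologicalSpace _ fun k =>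
        (A τ).isOpen_inter _ _ h₂.isOpen_dom (hA.isOpen_ne (hD s) (he s k))
  · intro V g hV hg
    rw [h₁.reg_iff _ _ (inCoordinates R₂ g ∘ P) (hcont V hV), hpre]
    · have hV' := (h₂.isOpen_iff V).1 hV
      have hN := hA.isOpen_preimage (A σ).isOpen_univ hP hV'
      exact (A σ).reg_mono hN ((A σ).isOpen_inter _ _ h₁.isOpen_dom hN) Set.inter_subset_right
        (hA.reg_comp (A σ).isOpen_univ hP hV' ((h₂.reg_iff_inCoordinates hV g).1 hg))
    · intro w x _ hw
      exact h₂.inCoordinates_eq g (hφ hw)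

/-! ### The holomorphic and the algebraic geometry -/

theorem isAffineGeometry_holomorphicAffine :
    IsAffineGeometry fun σ _ => holomorphicAffine σ where
  coord i x _ := (ContinuousLinearMap.proj (R := ℂ) i).analyticAt x
  reg_inv _ hf h0 x hx := (hf x hx).inv (h0 x hx)
  isOpen_ne {σ _ U f} hU hf := by
    have hU' : IsOpen U := hU
    have hc : ContinuousOn f U := fun x hx => (hf x hx).continuousAt.continuousWithinAt
    exact hc.isOpen_inter_preimage hU' isOpen_compl_singleton
  isOpen_preimage {σ τ _ _ U V φ} hU hφ hV := by
    have hU' : IsOpen U := hU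
    have hc : ContinuousOn φ U := continuousOn_pi.2 fun i x hx =>
      (hφ i x hx).continuousAt.continuousWithinAt
    exact hc.isOpen_inter_preimage hU' hV
  reg_comp {σ τ _ _ U V φ g} _ hφ _ hg x hx :=
    (hg (φ x) hx.2).comp (analyticAt_pi_iff.2 fun i => hφ i x hx.1)

section Algebraic

variable {σ : Type} {U : Set (σ → ℂ)} {f : (σ → ℂ) → ℂ}

theorem algebraicAffine_reg_inv (hf : (algebraicAffine σ).Reg U f) (h0 : ∀ x ∈ U, f x ≠ 0) :
    (algebraicAffine σ).Reg U fun x => (f x)⁻¹ := by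
  intro x hx
  obtain ⟨V, hV, hxV, p, q, hpq⟩ := hf x hx
  refine ⟨V, hV, hxV, q, p, fun y hy => ?_⟩
  obtain ⟨hq, hfy⟩ := hpq y hy
  refine ⟨fun hp => h0 y hy.2 (by rw [hfy, hp, zero_div]), ?_⟩
  change (f y)⁻¹ = _
  rw [hfy, inv_div]

theorem algebraicAffine_isOpen_ne (hU : (algebraicAffine σ).IsOpen U)
    (hf : (algebraicAffine σ).Reg U f) : (algebraicAffine σ).IsOpen {x | x ∈ U ∧ f x ≠ 0} := by
  rintro x ⟨hx, hfx⟩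
  obtain ⟨V, hV, hxV, p, q, hpq⟩ := hf x hx
  obtain ⟨a, ha, haV⟩ := (zariskiTopology σ).isOpen_inter V U hV hU x ⟨hxV, hx⟩
  -- Where `a` is nonzero, `f` is the fraction `p / q`, so it vanishes only with `p`.
  refine ⟨a * p, ?_, fun y hy => ?_⟩
  · rw [map_mul]
    refine mul_ne_zero ha fun hp => hfx ?_
    rw [(hpq x ⟨hxV, hx⟩).2, hp, zero_div]
  · rw [map_mul] at hy
    have hyV := haV y (left_ne_zero_of_mul hy)
    obtain ⟨hq, hfy⟩ := hpq y hyV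
    exact ⟨hyV.2, by rw [hfy]; exact div_ne_zero (right_ne_zero_of_mul hy) hq⟩

theorem algebraicAffine_reg_eval {τ : Type} {φ : (σ → ℂ) → τ → ℂ}
    (hU : (algebraicAffine σ).IsOpen U) (hφ : ∀ i, (algebraicAffine σ).Reg U fun x => φ x i)
    (p : MvPolynomial τ ℂ) : (algebraicAffine σ).Reg U fun x => MvPolynomial.eval (φ x) p := by
  induction p using MvPolynomial.induction_on with
  | C a => simpa using (algebraicAffine σ).reg_const a hU
  | add p q hp hq => simpa using (algebraicAffine σ).reg_add hU hp hq
  | mul_X p i hp => simpa using (algebraicAffine σ).reg_mul hU hp (hφ i)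

theorem algebraicAffine_isOpen_preimage {τ : Type} {φ : (σ → ℂ) → τ → ℂ} {V : Set (τ → ℂ)}
    (hU : (algebraicAffine σ).IsOpen U) (hφ : ∀ i, (algebraicAffine σ).Reg U fun x => φ x i)
    (hV : (algebraicAffine τ).IsOpen V) : (algebraicAffine σ).IsOpen (U ∩ φ ⁻¹' V) := by
  rintro x ⟨hx, hxV⟩
  obtain ⟨p, hp, hpV⟩ := hV (φ x) hxV
  obtain ⟨q, hq, hqU⟩ :=
    algebraicAffine_isOpen_ne hU (algebraicAffine_reg_eval hU hφ p) x ⟨hx, hp⟩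
  exact ⟨q, hq, fun y hy => ⟨(hqU y hy).1, hpV _ (hqU y hy).2⟩⟩

theorem isAffineGeometry_algebraicAffine :
    IsAffineGeometry fun σ _ => algebraicAffine σ where
  coord i _ _ := ⟨Set.univ, (zariskiTopology _).isOpen_univ, Set.mem_univ _, MvPolynomial.X i, 1,
    by simp⟩
  reg_inv _ hf h0 := algebraicAffine_reg_inv hf h0
  isOpen_ne := algebraicAffine_isOpen_ne
  isOpen_preimage := algebraicAffine_isOpen_preimage
  reg_comp {σ τ _ _ U V φ g} hU hφ hV hg := by
    have hW := algebraicAffine_isOpen_preimage hU hφ hV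
    refine (algebraicAffine σ).reg_local hW fun x hx => ?_
    obtain ⟨V', hV', hxV', p, q, hpq⟩ := hg (φ x) hx.2
    have hW' : (algebraicAffine σ).IsOpen (U ∩ φ ⁻¹' (V' ∩ V)) :=
      algebraicAffine_isOpen_preimage hU hφ ((algebraicAffine τ).isOpen_inter _ _ hV' hV)
    have heval (r : MvPolynomial τ ℂ) := (algebraicAffine σ).reg_mono hU hW'
      Set.inter_subset_left (algebraicAffine_reg_eval hU hφ r)
    refine ⟨_, hW', ⟨hx.1, hxV', hx.2⟩, (algebraicAffine σ).reg_congr hW' ?_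
      ((algebraicAffine σ).reg_mul hW' (heval p)
        (algebraicAffine_reg_inv (heval q) fun y hy => (hpq _ hy.2).1))⟩
    intro y hy
    simp only [Function.comp_apply]
    rw [(hpq _ hy.2).2, div_eq_mul_inv]

end Algebraic

end SpaceWithFunctions

/-! ### Combinatorics of the twelve pentagons -/

theorem card_image_pentagonEdges : (Finset.univ.image pentagonEdges).card = 12 := by
  decide +kernel

theorem dihedral_of_pentagonEdges_eq : ∀ τ : Equiv.Perm (Fin 5),
    pentagonEdges τ = pentagonEdges 1 → (∃ c, ∀ i, τ i = i + c) ∨ ∃ c, ∀ i, τ i = c - i := by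
  decide +kernel

theorem exists_perm_zero_two : ∀ i j : Fin 5, i ≠ j →
    ∃ p : Equiv.Perm (Fin 5), p 0 = i ∧ p 2 = j := by
  decide +kernel

/-- The 5-cycle has no three pairwise non-adjacent vertices. -/
theorem exists_adjacent_of_ne : ∀ i j k : Fin 5, i ≠ j → j ≠ k → i ≠ k →
    ∃ t, (t = i ∨ t = j ∨ t = k) ∧ (t + 1 = i ∨ t + 1 = j ∨ t + 1 = k) := by
  decide +kernel

theorem pentagonEdges_mul (p τ : Equiv.Perm (Fin 5)) :
    pentagonEdges (p * τ) = (pentagonEdges τ).image (Sym2.map p) := by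
  simp only [pentagonEdges, Finset.image_image]
  rfl

/-- Up to sign, the pentagon product depends only on the set of edges. -/
theorem exists_pentagonProduct_eq {p q : Equiv.Perm (Fin 5)}
    (h : pentagonEdges p = pentagonEdges q) :
    ∃ ε : ℂ, ∀ w, pentagonProduct q w = ε * pentagonProduct p w := by
  -- Relabelling by `p` reduces to the symmetries of the standard pentagon, which form the dihedral
  -- group.
  obtain ⟨τ, rfl⟩ : ∃ τ, q = p * τ := ⟨p⁻¹ * q, by simp⟩
  have hτ : pentagonEdges τ = pentagonEdges 1 := by
    have h1 : pentagonEdges (p * 1) = pentagonEdges (p * τ) := by rwa [mul_one]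
    rw [pentagonEdges_mul, pentagonEdges_mul] at h1
    exact (Finset.image_injective (Sym2.map.injective p.injective) h1).symm
  rcases dihedral_of_pentagonEdges_eq τ hτ with ⟨c, hc⟩ | ⟨c, hc⟩
  · refine ⟨1, fun w => ?_⟩
    simp only [pentagonProduct, Equiv.Perm.mul_apply, hc]
    fin_cases c <;> simp <;> ring
  -- A reflection reverses all five edges, and each reversal changes the sign of one factor.
  · refine ⟨-1, fun w => ?_⟩
    simp only [pentagonProduct, Equiv.Perm.mul_apply, hc, pointDiff]
    fin_cases c <;> simp [-zero_sub] <;> ring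

/-- Twelve different pentagons exhaust all pentagons, so every product is available from the listed
ones. -/
theorem exists_pentagonProduct_eq_of_injective {r : Fin 12 → Equiv.Perm (Fin 5)}
    (hr : Function.Injective fun s => pentagonEdges (r s)) (q : Equiv.Perm (Fin 5)) :
    ∃ (s : Fin 12) (ε : ℂ), ∀ w, pentagonProduct q w = ε * pentagonProduct (r s) w := by
  have hsub : (Finset.univ.image fun s => pentagonEdges (r s)) ⊆
      Finset.univ.image pentagonEdges := by
    intro e he
    obtain ⟨s, -, rfl⟩ := Finset.mem_image.1 he
    exact Finset.mem_image_of_mem _ (Finset.mem_univ _)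
  have heq := Finset.eq_of_subset_of_card_le hsub (by
    rw [card_image_pentagonEdges, Finset.card_image_of_injective _ hr]
    simp)
  have hq : pentagonEdges q ∈ Finset.univ.image fun s => pentagonEdges (r s) := by
    rw [heq]
    exact Finset.mem_image_of_mem _ (Finset.mem_univ _)
  obtain ⟨s, -, hs⟩ := Finset.mem_image.1 hq
  exact ⟨s, exists_pentagonProduct_eq hs⟩

theorem pointDiff_swap (w : Fin 5 × Fin 2 → ℂ) (i j : Fin 5) :
    pointDiff w j i = -pointDiff w i j := by
  simp only [pointDiff]
  ring

/-! ### Triple coincidences and the vanishing of pentagon products -/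

section Stability

variable (w : {w : Fin 5 × Fin 2 → ℂ | ∀ i, (fun a => w (i, a)) ≠ 0})

theorem fivePoints_eq_iff (i j : Fin 5) :
    fivePoints w i = fivePoints w j ↔ pointDiff w.1 i j = 0 := by
  rw [fivePoints, fivePoints, Projectivization.mk_eq_mk_iff']
  constructor
  · rintro ⟨a, ha⟩
    have h0 := congrFun ha 0
    have h1 := congrFun ha 1
    simp only [Pi.smul_apply, smul_eq_mul] at h0 h1
    rw [pointDiff, ← h0, ← h1]
    ring
  · intro h
    rw [pointDiff] at h
    by_cases h0 : w.1 (j, 0) = 0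
    · have h1 : w.1 (j, 1) ≠ 0 := fun h1 => w.2 j (by ext a; fin_cases a <;> simp [h0, h1])
      refine ⟨w.1 (i, 1) / w.1 (j, 1), ?_⟩
      ext a
      fin_cases a
      · simp only [Pi.smul_apply, smul_eq_mul, Fin.zero_eta]
        field_simp
        linear_combination h
      · simp [h1]
    · refine ⟨w.1 (i, 0) / w.1 (j, 0), ?_⟩
      ext a
      fin_cases a
      · simp [h0]
      · simp only [Pi.smul_apply, smul_eq_mul, Fin.mk_one]
        field_simp
        linear_combination -h

theorem exists_pentagonProduct_ne_zero (hw : fivePoints w ∈ tripleLocusᶜ) :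
    ∃ p, pentagonProduct p w.1 ≠ 0 := by
  have hd (i j : Fin 5) (h : fivePoints w i ≠ fivePoints w j) : pointDiff w.1 i j ≠ 0 :=
    fun h' => h ((fivePoints_eq_iff w i j).2 h')
  have ht (i j k : Fin 5) (hij : i ≠ j) (hjk : j ≠ k) (hik : i ≠ k)
      (h : fivePoints w i = fivePoints w j) : fivePoints w j ≠ fivePoints w k :=
    fun h' => hw ⟨i, j, k, hij, hjk, hik, h, h'⟩
  by_cases hinj : Function.Injective (fivePoints w)
  · refine ⟨1, ?_⟩
    simp only [pentagonProduct, mul_ne_zero_iff]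
    refine ⟨⟨⟨⟨?_, ?_⟩, ?_⟩, ?_⟩, ?_⟩ <;> exact hd _ _ (hinj.ne (by decide))
  · simp only [Function.Injective, not_forall] at hinj
    obtain ⟨i, j, hij, hne⟩ := hinj
    -- The coincident pair goes to the non-adjacent vertices 0 and 2. The only edge avoiding both is
    -- 34. If its ends also coincide, exchanging vertices 1 and 4 separates them, as a third point
    -- cannot join that pair.
    obtain ⟨p, hp⟩ : ∃ p : Equiv.Perm (Fin 5), fivePoints w (p 0) = fivePoints w (p 2) ∧
        fivePoints w (p 3) ≠ fivePoints w (p 4) := by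
      obtain ⟨p, rfl, rfl⟩ := exists_perm_zero_two i j hne
      by_cases h34 : fivePoints w (p 3) = fivePoints w (p 4)
      · refine ⟨p * Equiv.swap 1 4, ?_⟩
        simp only [Equiv.Perm.mul_apply, Equiv.swap_apply_def, Fin.reduceEq, if_true, if_false]
        refine ⟨hij, ?_⟩
        rw [h34]
        exact ht (p 3) (p 4) (p 1) (p.injective.ne (by decide)) (p.injective.ne (by decide))
          (p.injective.ne (by decide)) h34
      · exact ⟨p, hij, h34⟩
    obtain ⟨h02, h34⟩ := hp
    have h0 (k : Fin 5) (hk0 : k ≠ 0) (hk2 : k ≠ 2) : fivePoints w (p 0) ≠ fivePoints w (p k) := by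
      rw [h02]
      exact ht (p 0) (p 2) (p k) (p.injective.ne (by decide)) (p.injective.ne hk2.symm)
        (p.injective.ne hk0.symm) h02
    refine ⟨p, ?_⟩
    simp only [pentagonProduct, mul_ne_zero_iff]
    refine ⟨⟨⟨⟨hd _ _ (h0 1 (by decide) (by decide)), hd _ _ ?_⟩, hd _ _ ?_⟩, hd _ _ h34⟩,
      hd _ _ (h0 4 (by decide) (by decide)).symm⟩
    · rw [← h02]
      exact (h0 1 (by decide) (by decide)).symm
    · rw [← h02]
      exact h0 3 (by decide) (by decide)

end Stability

theorem pointDiff_ne_zero_of_pentagonProduct_ne_zero {p : Equiv.Perm (Fin 5)}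
    {w : Fin 5 × Fin 2 → ℂ} (h : pentagonProduct p w ≠ 0) (t : Fin 5) :
    pointDiff w (p t) (p (t + 1)) ≠ 0 := by
  simp only [pentagonProduct, mul_ne_zero_iff] at h
  obtain ⟨⟨⟨⟨h0, h1⟩, h2⟩, h3⟩, h4⟩ := h
  fin_cases t <;> assumption

theorem stable_of_pentagonProduct_ne_zero {p : Equiv.Perm (Fin 5)} {w : Fin 5 × Fin 2 → ℂ}
    (h : pentagonProduct p w ≠ 0) :
    ∃ hw : ∀ i, (fun a => w (i, a)) ≠ 0, fivePoints ⟨w, hw⟩ ∈ tripleLocusᶜ := by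
  have hd := pointDiff_ne_zero_of_pentagonProduct_ne_zero h
  have hw (i) : (fun a => w (i, a)) ≠ 0 := by
    intro hi
    refine hd (p.symm i) ?_
    have h0 := congrFun hi 0
    have h1 := congrFun hi 1
    simp only [Pi.zero_apply] at h0 h1
    simp [pointDiff, h0, h1]
  refine ⟨hw, ?_⟩
  · rintro ⟨i, j, k, hij, hjk, hik, h1, h2⟩
    obtain ⟨t, ht, ht'⟩ := exists_adjacent_of_ne (p.symm i) (p.symm j) (p.symm k)
      (p.symm.injective.ne hij) (p.symm.injective.ne hjk) (p.symm.injective.ne hik)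
    refine hd t ((fivePoints_eq_iff ⟨w, hw⟩ _ _).1 ?_)
    simp only [Equiv.eq_symm_apply] at ht ht'
    rcases ht with ht | ht | ht <;> rcases ht' with ht' | ht' | ht' <;> rw [ht, ht'] <;>
      simp only [h1, h2]

/-! ### Homogeneous coordinates on X(2,5) -/

/-- `w` is a system of homogeneous coordinates of a configuration whose class is `x`. -/
def ConfigSpace.HasCoordinates (w : Fin 5 × Fin 2 → ℂ) (x : ConfigSpace) : Prop :=
  ∃ (h : ∀ i, (fun a => w (i, a)) ≠ 0) (h' : fivePoints ⟨w, h⟩ ∈ tripleLocusᶜ),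
    ConfigSpace.mk ⟨fivePoints ⟨w, h⟩, h'⟩ = x

/-- The two systems of coordinates differ by a matrix, acting diagonally on the five vectors, and
by a rescaling of the vectors. -/
def CoordinatesEquiv (w w' : Fin 5 × Fin 2 → ℂ) : Prop :=
  ∃ M : Matrix (Fin 2) (Fin 2) ℂ, M.det ≠ 0 ∧ ∃ c : Fin 5 → ℂ, (∀ i, c i ≠ 0) ∧
    ∀ i a, w (i, a) = c i * (M.mulVec fun b => w' (i, b)) a

theorem CoordinatesEquiv.pointDiff_eq {w w' : Fin 5 × Fin 2 → ℂ}
    {M : Matrix (Fin 2) (Fin 2) ℂ} {c : Fin 5 → ℂ}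
    (h : ∀ i a, w (i, a) = c i * (M.mulVec fun b => w' (i, b)) a) (i j : Fin 5) :
    pointDiff w i j = c i * c j * M.det * pointDiff w' i j := by
  simp only [pointDiff, h, Matrix.mulVec, dotProduct, Fin.sum_univ_two, Matrix.det_fin_two]
  ring

theorem CoordinatesEquiv.exists_pentagonProduct_eq {w w' : Fin 5 × Fin 2 → ℂ}
    (h : CoordinatesEquiv w w') :
    ∃ u : ℂ, u ≠ 0 ∧ ∀ p, pentagonProduct p w = u * pentagonProduct p w' := by
  obtain ⟨M, hM, c, hc, h⟩ := h
  -- Each vertex lies on two of the five edges, and each edge contributes one determinant.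
  refine ⟨(∏ i, c i) ^ 2 * M.det ^ 5, mul_ne_zero
    (pow_ne_zero _ (Finset.prod_ne_zero_iff.2 fun i _ => hc i)) (pow_ne_zero _ hM), fun p => ?_⟩
  rw [← Equiv.prod_comp p c]
  simp only [pentagonProduct, pointDiff_eq h, Fin.prod_univ_five]
  ring

namespace ConfigSpace

variable {w w' : Fin 5 × Fin 2 → ℂ} {x : ConfigSpace}

theorem HasCoordinates.exists_pentagonProduct_ne_zero (h : HasCoordinates w x) :
    ∃ p, pentagonProduct p w ≠ 0 := by
  obtain ⟨h, h', -⟩ := h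
  exact _root_.exists_pentagonProduct_ne_zero ⟨w, h⟩ h'

theorem exists_hasCoordinates_of_pentagonProduct_ne_zero {p : Equiv.Perm (Fin 5)}
    (h : pentagonProduct p w ≠ 0) : ∃ x, HasCoordinates w x := by
  obtain ⟨h, h'⟩ := stable_of_pentagonProduct_ne_zero h
  exact ⟨_, h, h', rfl⟩

theorem HasCoordinates.equiv (h : HasCoordinates w x) (h' : HasCoordinates w' x) :
    CoordinatesEquiv w w' := by
  obtain ⟨h, hs, rfl⟩ := h
  obtain ⟨h', hs', heq⟩ := h'
  obtain ⟨g, hg⟩ := Quotient.exact heq.symm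
  obtain ⟨M, rfl⟩ := Matrix.ProjGenLinGroup.mk_surjective g
  have key (i : Fin 5) : ∃ c : ℂ, c • (M • fun a => w' (i, a)) = fun a => w (i, a) := by
    have := congrFun hg i
    exact (Projectivization.mk_eq_mk_iff' ..).1 this.symm
  choose c hc using key
  refine ⟨M.1, ?_, c, fun i hi => h i ?_, fun i a => ?_⟩
  · exact ((Matrix.isUnit_iff_isUnit_det _).1 M.isUnit).ne_zero
  · rw [← hc i, hi, zero_smul]
  · exact (congrFun (hc i) a).symm

theorem HasCoordinates.of_equiv (h : HasCoordinates w' x) (he : CoordinatesEquiv w w') :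
    HasCoordinates w x := by
  obtain ⟨p, hp⟩ := h.exists_pentagonProduct_ne_zero
  obtain ⟨u, hu, hpu⟩ := he.exists_pentagonProduct_eq
  -- The absence of triple coincidences passes from `w'` to `w` through a nonzero pentagon product.
  obtain ⟨hw, hs⟩ := stable_of_pentagonProduct_ne_zero (p := p) (w := w) (by
    rw [hpu]
    exact mul_ne_zero hu hp)
  obtain ⟨hw', hs', rfl⟩ := h
  obtain ⟨M, hM, c, hc, he⟩ := he
  refine ⟨hw, hs, Quotient.sound
    ⟨Matrix.ProjGenLinGroup.mk (Matrix.GeneralLinearGroup.mkOfDetNeZero M hM), ?_⟩⟩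
  funext i
  refine ((Projectivization.mk_eq_mk_iff' ..).2 ⟨c i, ?_⟩ : _ = _).symm
  ext a
  exact (he i a).symm

end ConfigSpace

/-! ### Frieze normal form and its recovery from pentagon products -/

/-- The frieze normal form: five vectors `v₀, …, v₄` with `v_{k+1} = a_k v_k - v_{k-1}`, placed at
the vertices of the pentagon `p`. -/
noncomputable def frieze (p : Equiv.Perm (Fin 5)) (a b c : ℂ) (i : Fin 5 × Fin 2) : ℂ :=
  (![![0, 1], ![1, 0], ![a, -1], ![a * b - 1, -b], ![a * b * c - c - a, 1 - b * c]] :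
    Fin 5 → Fin 2 → ℂ) (p.symm i.1) i.2


/-- The ratio `- J(q) / J(p) - 1` of pentagon products. -/
noncomputable def pentagonRatio (p q : Equiv.Perm (Fin 5)) (w : Fin 5 × Fin 2 → ℂ) : ℂ :=
  -(pentagonProduct q w / pentagonProduct p w) - 1

theorem plucker (w : Fin 5 × Fin 2 → ℂ) (i j k l : Fin 5) :
    pointDiff w i k * pointDiff w j l =
      pointDiff w i j * pointDiff w k l + pointDiff w i l * pointDiff w j k := by
  simp only [pointDiff]
  ring

section Frieze

variable {p : Equiv.Perm (Fin 5)} {w : Fin 5 × Fin 2 → ℂ}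

/-- Exchanging neighbours alters only three edges, one of them just by a sign. The three-term
Plücker relation then turns the ratio minus one into a single cross-ratio-like monomial, which is
d(02) once the consecutive differences and d(04) are 1. The next two lemmas give d(13) and d(24) in
the same way. -/
theorem pentagonRatio_swap_three_four (h : pentagonProduct p w ≠ 0) :
    pentagonRatio p (p * Equiv.swap 3 4) w =
      pointDiff w (p 0) (p 2) * pointDiff w (p 3) (p 4) /
        (pointDiff w (p 0) (p 4) * pointDiff w (p 2) (p 3)) := by
  have h' := h
  simp only [pentagonProduct, mul_ne_zero_iff] at h'
  obtain ⟨⟨⟨⟨h0, h1⟩, h2⟩, h3⟩, h4⟩ := h'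
  rw [pointDiff_swap w (p 0), neg_ne_zero] at h4
  have := plucker w (p 0) (p 2) (p 3) (p 4)
  simp only [pentagonRatio, pentagonProduct, Equiv.Perm.mul_apply, Equiv.swap_apply_def,
    Fin.reduceEq, if_true, if_false]
  rw [pointDiff_swap w (p 0) (p 4), pointDiff_swap w (p 0) (p 3), pointDiff_swap w (p 3) (p 4)]
  field_simp
  linear_combination this

theorem pentagonRatio_swap_four_zero (h : pentagonProduct p w ≠ 0) :
    pentagonRatio p (p * Equiv.swap 4 0) w =
      pointDiff w (p 1) (p 3) * pointDiff w (p 0) (p 4) /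
        (pointDiff w (p 3) (p 4) * pointDiff w (p 0) (p 1)) := by
  have h' := h
  simp only [pentagonProduct, mul_ne_zero_iff] at h'
  obtain ⟨⟨⟨⟨h0, h1⟩, h2⟩, h3⟩, h4⟩ := h'
  rw [pointDiff_swap w (p 0), neg_ne_zero] at h4
  have := plucker w (p 0) (p 1) (p 3) (p 4)
  simp only [pentagonRatio, pentagonProduct, Equiv.Perm.mul_apply, Equiv.swap_apply_def,
    Fin.reduceEq, if_true, if_false]
  rw [pointDiff_swap w (p 0) (p 4), pointDiff_swap w (p 0) (p 3), pointDiff_swap w (p 1) (p 4)]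
  field_simp
  linear_combination this

theorem pentagonRatio_swap_zero_one (h : pentagonProduct p w ≠ 0) :
    pentagonRatio p (p * Equiv.swap 0 1) w =
      pointDiff w (p 2) (p 4) * pointDiff w (p 0) (p 1) /
        (pointDiff w (p 0) (p 4) * pointDiff w (p 1) (p 2)) := by
  have h' := h
  simp only [pentagonProduct, mul_ne_zero_iff] at h'
  obtain ⟨⟨⟨⟨h0, h1⟩, h2⟩, h3⟩, h4⟩ := h'
  rw [pointDiff_swap w (p 0), neg_ne_zero] at h4
  have := plucker w (p 0) (p 1) (p 2) (p 4)
  simp only [pentagonRatio, pentagonProduct, Equiv.Perm.mul_apply, Equiv.swap_apply_def,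
    Fin.reduceEq, if_true, if_false]
  rw [pointDiff_swap w (p 0) (p 4), pointDiff_swap w (p 0) (p 1), pointDiff_swap w (p 1) (p 4)]
  field_simp
  linear_combination this

/-- The first four factors are 1; the last one measures whether the frieze closes up. -/
theorem pentagonProduct_frieze (p : Equiv.Perm (Fin 5)) (a b c : ℂ) :
    pentagonProduct p (frieze p a b c) = -(a * b * c - c - a) := by
  simp [pentagonProduct, pointDiff, frieze]
  ring

/-- A configuration with consecutive points of the pentagon `p` distinct is equivalent to a frieze,
and this frieze closes up. -/
theorem frieze_pentagonRatio (h : pentagonProduct p w ≠ 0) {a b c : ℂ}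
    (ha : a = pentagonRatio p (p * Equiv.swap 3 4) w)
    (hb : b = pentagonRatio p (p * Equiv.swap 4 0) w)
    (hc : c = pentagonRatio p (p * Equiv.swap 0 1) w) :
    a * b * c - c - a = 1 ∧ CoordinatesEquiv (frieze p a b c) w := by
  rw [pentagonRatio_swap_three_four h] at ha
  rw [pentagonRatio_swap_four_zero h] at hb
  rw [pentagonRatio_swap_zero_one h] at hc
  simp only [pentagonProduct, mul_ne_zero_iff] at h
  obtain ⟨⟨⟨⟨h01, h12⟩, h23⟩, h34⟩, h04⟩ := h
  rw [pointDiff_swap w (p 0), neg_ne_zero] at h04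
  have hd (j k : Fin 5) : pointDiff w (p j) (p k) =
      w (p j, 1) * w (p k, 0) + -w (p j, 0) * w (p k, 1) := by
    simp only [pointDiff]
    ring
  have h0123 := plucker w (p 0) (p 1) (p 2) (p 3)
  have h1234 := plucker w (p 1) (p 2) (p 3) (p 4)
  have h0234 := plucker w (p 0) (p 2) (p 3) (p 4)
  have hself (j : Fin 5) : pointDiff w j j = 0 := by
    simp only [pointDiff]
    ring
  have h10 := pointDiff_swap w (p 0) (p 1)
  generalize hd01 : pointDiff w (p 0) (p 1) = d01 at *
  generalize hd12 : pointDiff w (p 1) (p 2) = d12 at *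
  generalize hd23 : pointDiff w (p 2) (p 3) = d23 at *
  generalize hd34 : pointDiff w (p 3) (p 4) = d34 at *
  generalize hd04 : pointDiff w (p 0) (p 4) = d04 at *
  generalize hd02 : pointDiff w (p 0) (p 2) = d02 at *
  generalize hd13 : pointDiff w (p 1) (p 3) = d13 at *
  generalize hd24 : pointDiff w (p 2) (p 4) = d24 at *
  generalize hd03 : pointDiff w (p 0) (p 3) = d03 at *
  generalize hd14 : pointDiff w (p 1) (p 4) = d14 at *
  -- In normalised coordinates `a * b - 1` is d(03) and `b * c - 1` is d(14). Closing up is then the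
  -- Plücker relation among the points 0, 2, 3, 4.
  have hab : a * b - 1 = d12 * d03 / (d01 * d23) := by
    rw [ha, hb]
    field_simp
    linear_combination h0123
  have hbc : 1 - b * c = -(d23 * d14 / (d34 * d12)) := by
    rw [hb, hc]
    field_simp
    linear_combination -h1234
  have habc : a * b * c - c - a = 1 := by
    have : a * b * c - c - a = c * (a * b - 1) - a := by ring
    rw [this, hab, hc, ha]
    field_simp
    linear_combination h0234
  -- The rows are multiples of the linear forms d(0,·) and d(1,·), so they send the vectors 0 and 1
  -- to the coordinate axes. The factors are chosen so that the remaining rescalings are rational in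
  -- the d(jk), without square roots.
  refine ⟨habc, !![-(d34 * d12) * w (p 0, 1), -(d34 * d12) * -w (p 0, 0);
    d04 * d23 * w (p 1, 1), d04 * d23 * -w (p 1, 0)], ?_,
    fun i => -(![d04 * d23 * d01, d34 * d12 * d01, d04 * d23 * d12, d34 * d01 * d23,
      d34 * d12 * d04] (p.symm i))⁻¹, ?_, ?_⟩
  · have : Matrix.det !![-(d34 * d12) * w (p 0, 1), -(d34 * d12) * -w (p 0, 0);
        d04 * d23 * w (p 1, 1), d04 * d23 * -w (p 1, 0)] = -(d34 * d12) * (d04 * d23) * -d01 := by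
      rw [Matrix.det_fin_two_of, ← h10, pointDiff]
      ring
    rw [this]
    simp [h34, h12, h04, h23, h01]
  · intro i
    obtain ⟨k, rfl⟩ := p.surjective i
    simp only [Equiv.symm_apply_apply]
    fin_cases k <;> simp [h34, h12, h04, h23, h01]
  · intro i e
    obtain ⟨k, rfl⟩ := p.surjective i
    have hrow : (Matrix.mulVec !![-(d34 * d12) * w (p 0, 1), -(d34 * d12) * -w (p 0, 0);
        d04 * d23 * w (p 1, 1), d04 * d23 * -w (p 1, 0)] fun e => w (p k, e)) e =
        ![-(d34 * d12) * pointDiff w (p 0) (p k), d04 * d23 * pointDiff w (p 1) (p k)] e := by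
      simp only [hd]
      fin_cases e <;> simp [Matrix.mulVec, dotProduct, Fin.sum_univ_two] <;> ring
    rw [hrow]
    simp only [frieze, Equiv.symm_apply_apply]
    fin_cases k <;> fin_cases e <;>
      simp [hself, h10, hd01, hd12, hd02, hd03, hd13, hd04, hd14, hab, hbc, habc] <;>
      (try rw [ha]) <;> (try rw [hb]) <;> field_simp

end Frieze

/-! ### Regularity of the formulas and presentations of the two spaces -/

namespace SpaceWithFunctions

section Reg

variable {X : Type} (A : SpaceWithFunctions X) {U : Set X} {f g : X → ℂ}

theorem reg_neg (hU : A.IsOpen U) (hf : A.Reg U f) : A.Reg U fun x => -f x := by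
  simpa using A.reg_mul hU (A.reg_const (-1) hU) hf

theorem reg_sub (hU : A.IsOpen U) (hf : A.Reg U f) (hg : A.Reg U g) :
    A.Reg U fun x => f x - g x := by
  simpa [sub_eq_add_neg] using A.reg_add hU hf (A.reg_neg hU hg)

theorem reg_pointDiff (A : SpaceWithFunctions X) {ρ : X → Fin 5 × Fin 2 → ℂ} (hU : A.IsOpen U)
    (hρ : ∀ i, A.Reg U fun x => ρ x i) (i j : Fin 5) : A.Reg U fun x => pointDiff (ρ x) i j :=
  A.reg_sub hU (A.reg_mul hU (hρ _) (hρ _)) (A.reg_mul hU (hρ _) (hρ _))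

theorem reg_pentagonProduct (A : SpaceWithFunctions X) {ρ : X → Fin 5 × Fin 2 → ℂ}
    (hU : A.IsOpen U) (hρ : ∀ i, A.Reg U fun x => ρ x i) (p : Equiv.Perm (Fin 5)) :
    A.Reg U fun x => pentagonProduct p (ρ x) :=
  have hd := A.reg_pointDiff hU hρ
  A.reg_mul hU (A.reg_mul hU (A.reg_mul hU (A.reg_mul hU (hd _ _) (hd _ _)) (hd _ _)) (hd _ _))
    (hd _ _)

theorem reg_frieze (A : SpaceWithFunctions X) (hU : A.IsOpen U) {a b c : X → ℂ}
    (ha : A.Reg U a) (hb : A.Reg U b) (hc : A.Reg U c) (p : Equiv.Perm (Fin 5))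
    (i : Fin 5 × Fin 2) : A.Reg U fun x => frieze p (a x) (b x) (c x) i := by
  obtain ⟨i, e⟩ := i
  obtain ⟨k, rfl⟩ := p.surjective i
  simp only [frieze, Equiv.symm_apply_apply]
  have hconst (z : ℂ) := A.reg_const z hU
  have hab := A.reg_mul hU ha hb
  fin_cases k <;> fin_cases e
  · exact hconst 0
  · exact hconst 1
  · exact hconst 1
  · exact hconst 0
  · exact ha
  · exact hconst (-1)
  · exact A.reg_sub hU hab (hconst 1)
  · exact A.reg_neg hU hb
  · exact A.reg_sub hU (A.reg_sub hU (A.reg_mul hU hab hc) hc) ha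
  · exact A.reg_sub hU (hconst 1) (A.reg_mul hU hb hc)

end Reg

variable {A : ∀ (σ : Type) [Fintype σ], SpaceWithFunctions (σ → ℂ)}

theorem IsAffineGeometry.isOpen_ne_zero (hA : IsAffineGeometry A) (n : ℕ) :
    (A (Fin n)).IsOpen {v | v ≠ 0} := by
  have : {v : Fin n → ℂ | v ≠ 0} = ⋃ i, {v | v ∈ Set.univ ∧ v i ≠ 0} := by
    ext v
    simp [Function.ne_iff]
  rw [this]
  exact @isOpen_iUnion _ _ (A (Fin n)).toTopologicalSpace _ fun i =>
    hA.isOpen_ne (A (Fin n)).isOpen_univ (hA.coord i)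

theorem IsAffineGeometry.presents_projectiveSpace (hA : IsAffineGeometry A) (n : ℕ) :
    Presents (A (Fin n)) (fun z y => ∃ h : z ≠ 0, Projectivization.mk ℂ z h = y)
      (projectiveSpace n (A (Fin n))) := by
  refine ((presents_restrict _ (hA.isOpen_ne_zero n)).trans (presents_quotient _ ?_)).congr ?_
  · intro y
    exact ⟨⟨y.rep, y.rep_nonzero⟩, y.mk_rep⟩
  · intro z y
    constructor
    · rintro ⟨x, rfl, h⟩
      exact ⟨x.2, h⟩
    · rintro ⟨h, hz⟩
      exact ⟨⟨z, h⟩, rfl, hz⟩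

theorem fivePoints_surjective : Function.Surjective fivePoints := fun l =>
  ⟨⟨fun i => (l i.1).rep i.2, fun i => (l i).rep_nonzero⟩, funext fun i => (l i).mk_rep⟩

theorem IsAffineGeometry.presents_configStructure (hA : IsAffineGeometry A) :
    Presents (A (Fin 5 × Fin 2)) ConfigSpace.HasCoordinates
      (configStructure (A (Fin 5 × Fin 2))) := by
  have hS : (A (Fin 5 × Fin 2)).IsOpen {w | ∀ i, (fun a => w (i, a)) ≠ 0} := by
    have : {w : Fin 5 × Fin 2 → ℂ | ∀ i, (fun a => w (i, a)) ≠ 0} =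
        ⋂ i, (Set.univ ∩ (fun w a => w (i, a)) ⁻¹' {v : Fin 2 → ℂ | v ≠ 0}) := by
      ext w
      simp
    rw [this]
    exact @isOpen_iInter_of_finite _ _ (A (Fin 5 × Fin 2)).toTopologicalSpace _ _ fun i =>
      hA.isOpen_preimage (A (Fin 5 × Fin 2)).isOpen_univ (fun a => hA.coord (i, a))
        (hA.isOpen_ne_zero 2)
  have h₁ := (presents_restrict _ hS).trans (presents_quotient _ fivePoints_surjective)
  have hT : (((A (Fin 5 × Fin 2)).restrict {w | ∀ i, (fun a => w (i, a)) ≠ 0}).quotient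
      fivePoints).IsOpen tripleLocusᶜ := by
    rw [h₁.isOpen_iff]
    -- The complement of the triple locus is open because it is the union of the nonvanishing loci
    -- of the pentagon products.
    have : {w : Fin 5 × Fin 2 → ℂ | ∃ l ∈ tripleLocusᶜ, ∃ v : {w : Fin 5 × Fin 2 → ℂ | ∀ i, (fun a => w (i, a)) ≠ 0},
        w = v.1 ∧ fivePoints v = l} = ⋃ p, {w | w ∈ Set.univ ∧ pentagonProduct p w ≠ 0} := by
      ext w
      simp only [Set.mem_iUnion]
      constructor
      · rintro ⟨_, hl, w, rfl, rfl⟩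
        obtain ⟨p, hp⟩ := exists_pentagonProduct_ne_zero w hl
        exact ⟨p, trivial, hp⟩
      · rintro ⟨p, -, hp⟩
        obtain ⟨h, hs⟩ := stable_of_pentagonProduct_ne_zero hp
        exact ⟨_, hs, ⟨w, h⟩, rfl, rfl⟩
    rw [this]
    have hU := (A (Fin 5 × Fin 2)).isOpen_univ
    exact @isOpen_iUnion _ _ (A (Fin 5 × Fin 2)).toTopologicalSpace _ fun p =>
      hA.isOpen_ne hU ((A (Fin 5 × Fin 2)).reg_pentagonProduct hU hA.coord p)
  refine ((h₁.trans (presents_restrict _ hT)).trans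
    (presents_quotient _ Quotient.mk_surjective)).congr fun w x => ?_
  constructor
  · rintro ⟨l, ⟨_, ⟨w, rfl, rfl⟩, hl⟩, rfl⟩
    obtain ⟨l, hs⟩ := l
    obtain rfl : fivePoints w = l := hl
    exact ⟨w.2, hs, rfl⟩
  · rintro ⟨h, hs, rfl⟩
    exact ⟨⟨_, hs⟩, ⟨_, ⟨⟨w, h⟩, rfl, rfl⟩, rfl⟩, rfl⟩

end SpaceWithFunctions

/-! ### The embedding by pentagon products -/

open SpaceWithFunctions ConfigSpace in
theorem mainTheorem11 (r : Fin 12 → Equiv.Perm (Fin 5))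
    (hr : Function.Injective fun s => pentagonEdges (r s)) :
    ∃ J : ConfigSpace → ℙ ℂ (Fin 12 → ℂ),
      (∀ (w : {w : Fin 5 × Fin 2 → ℂ | ∀ i, (fun a => w (i, a)) ≠ 0})
        (hw : fivePoints w ∈ tripleLocusᶜ),
        ∃ h : (fun s => pentagonProduct (r s) w.1) ≠ 0,
          J (ConfigSpace.mk ⟨fivePoints w, hw⟩) =
            Projectivization.mk ℂ (fun s => pentagonProduct (r s) w.1) h) ∧
      SpaceWithFunctions.IsClosedEmbedding
        (configStructure (SpaceWithFunctions.algebraicAffine (Fin 5 × Fin 2)))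
        (SpaceWithFunctions.projectiveSpace 12 (SpaceWithFunctions.algebraicAffine (Fin 12))) J ∧
      SpaceWithFunctions.IsClosedEmbedding
        (configStructure (SpaceWithFunctions.holomorphicAffine (Fin 5 × Fin 2)))
        (SpaceWithFunctions.projectiveSpace 12 (SpaceWithFunctions.holomorphicAffine (Fin 12)))
        J := by
  choose idx ε hε using exists_pentagonProduct_eq_of_injective hr
  let P (w : Fin 5 × Fin 2 → ℂ) (s : Fin 12) : ℂ := pentagonProduct (r s) w
  have hP0 {w x} (h : HasCoordinates w x) : P w ≠ 0 := by
    obtain ⟨p, hp⟩ := h.exists_pentagonProduct_ne_zero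
    intro h0
    refine hp ?_
    rw [hε]
    exact mul_eq_zero_of_right _ (congrFun h0 (idx p))
  have hex (x : ConfigSpace) : ∃ w, HasCoordinates w x :=
    isAffineGeometry_holomorphicAffine.presents_configStructure.surj x
  choose W hW using hex
  let J (x : ConfigSpace) : ℙ ℂ (Fin 12 → ℂ) := Projectivization.mk ℂ (P (W x)) (hP0 (hW x))
  let R₂ (z : Fin 12 → ℂ) (y : ℙ ℂ (Fin 12 → ℂ)) : Prop :=
    ∃ h : z ≠ 0, Projectivization.mk ℂ z h = y
  have hJ {w x} (h : HasCoordinates w x) : R₂ (P w) (J x) := by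
    refine ⟨hP0 h, (Projectivization.mk_eq_mk_iff' ..).2 ?_⟩
    obtain ⟨u, -, hu⟩ := (h.equiv (hW x)).exists_pentagonProduct_eq
    exact ⟨u, funext fun s => (hu _).symm⟩
  have hR₂ {z z' y} (h : R₂ z y) (h' : R₂ z' y) : ∃ c : ℂ, c ≠ 0 ∧ ∀ s, z s = c * z' s := by
    obtain ⟨h0, rfl⟩ := h
    obtain ⟨h0', h'⟩ := h'
    obtain ⟨c, hc⟩ := (Projectivization.mk_eq_mk_iff' ..).1 h'.symm
    refine ⟨c, ?_, fun s => (congrFun hc s).symm⟩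
    rintro rfl
    exact h0 (by rw [← hc, zero_smul])
  -- The pentagon ratio as a function of the target coordinates, homogeneous of degree 0. The
  -- product for `r s * τ` is recovered from the listed one with index `idx`, up to the factor `ε`.
  let T (s : Fin 12) (τ : Equiv.Perm (Fin 5)) (z : Fin 12 → ℂ) : ℂ :=
    -(ε (r s * τ) * z (idx (r s * τ)) * (z s)⁻¹) - 1
  let ρ (s : Fin 12) (z : Fin 12 → ℂ) : Fin 5 × Fin 2 → ℂ := frieze (r s)
    (T s (Equiv.swap 3 4) z) (T s (Equiv.swap 4 0) z) (T s (Equiv.swap 0 1) z)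
  have hT (s τ w) : T s τ (P w) = pentagonRatio (r s) (r s * τ) w := by
    simp only [T, pentagonRatio, hε (r s * τ) w, P, div_eq_mul_inv]
  have hTc {z z' : Fin 12 → ℂ} {c : ℂ} (hc : c ≠ 0) (h : ∀ s, z s = c * z' s) (s τ) :
      T s τ z = T s τ z' := by
    simp only [T, h, mul_inv]
    field_simp
  have hfr {s w} (h : P w s ≠ 0) := frieze_pentagonRatio (p := r s) (w := w) h
    (hT s (Equiv.swap 3 4) w) (hT s (Equiv.swap 4 0) w) (hT s (Equiv.swap 0 1) w)
  have hinv {s z z' y} (h : R₂ z y) (h' : R₂ z' y) (hz : z s ≠ 0) :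
      z' s ≠ 0 ∧ ρ s z = ρ s z' := by
    obtain ⟨c, hc, hzz⟩ := hR₂ h h'
    refine ⟨fun h0 => hz (by rw [hzz, h0, mul_zero]), ?_⟩
    simp only [ρ, hTc hc hzz]
  have hsec {s w x} (h : HasCoordinates w x) (hs : P w s ≠ 0) : HasCoordinates (ρ s (P w)) x :=
    h.of_equiv (hfr hs).2
  -- For a point of the image, `ρ s z` is a closed frieze, whose product at `s` is -1; this fixes
  -- the proportionality factor between `z` and its products. Conversely, the equation at `k = s`
  -- keeps that product nonzero, so `ρ s z` represents a configuration, and the other equations say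
  -- that it maps to `y`.
  have hrange {s z y} (h : R₂ z y) (hz : z s ≠ 0) :
      y ∈ Set.range J ↔ ∀ k, P (ρ s z) k * z s + z k = 0 := by
    constructor
    · rintro ⟨x, rfl⟩ k
      obtain ⟨hs, heq⟩ := hinv h (hJ (hW x)) hz
      rw [heq]
      obtain ⟨c, -, hc⟩ := hR₂ (hJ (hsec (hW x) hs)) h
      have h1 : P (ρ s (P (W x))) s = -1 := by
        change pentagonProduct _ (frieze _ _ _ _) = _
        rw [pentagonProduct_frieze, (hfr hs).1]
      rw [hc s] at h1
      rw [hc k]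
      linear_combination z k * h1
    · intro hk
      have hs : P (ρ s z) s ≠ 0 := by
        intro h0
        have := hk s
        rw [h0, zero_mul, zero_add] at this
        exact hz this
      obtain ⟨x, hx⟩ := exists_hasCoordinates_of_pentagonProduct_ne_zero (p := r s) hs
      refine ⟨x, ?_⟩
      obtain ⟨h0, hx'⟩ := hJ hx
      obtain ⟨h0', rfl⟩ := h
      rw [← hx']
      refine ((Projectivization.mk_eq_mk_iff' ..).2 ⟨-z s, ?_⟩).symm
      funext k
      simp only [Pi.smul_apply, smul_eq_mul]
      linear_combination -hk k
  have main {A : ∀ (σ : Type) [Fintype σ], SpaceWithFunctions (σ → ℂ)}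
      (hA : IsAffineGeometry A) : SpaceWithFunctions.IsClosedEmbedding
        (configStructure (A (Fin 5 × Fin 2))) (projectiveSpace 12 (A (Fin 12))) J := by
    have hD (s : Fin 12) : (A (Fin 12)).IsOpen {z | z ∈ Set.univ ∧ z s ≠ 0} :=
      hA.isOpen_ne (A (Fin 12)).isOpen_univ (hA.coord s)
    have hcoord (s k : Fin 12) : (A (Fin 12)).Reg {z | z ∈ Set.univ ∧ z s ≠ 0} fun z => z k :=
      (A (Fin 12)).reg_mono (A (Fin 12)).isOpen_univ (hD s) (Set.subset_univ _) (hA.coord k)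
    have hTreg (s τ) : (A (Fin 12)).Reg {z | z ∈ Set.univ ∧ z s ≠ 0} (T s τ) :=
      (A (Fin 12)).reg_sub (hD s) ((A (Fin 12)).reg_neg (hD s) ((A (Fin 12)).reg_mul (hD s)
        ((A (Fin 12)).reg_mul (hD s) ((A (Fin 12)).reg_const _ (hD s)) (hcoord s _))
        (hA.reg_inv (hD s) (hcoord s s) fun z hz => hz.2))) ((A (Fin 12)).reg_const 1 (hD s))
    have hρ (s i) : (A (Fin 12)).Reg {z | z ∈ Set.univ ∧ z s ≠ 0} fun z => ρ s z i :=
      (A (Fin 12)).reg_frieze (hD s) (hTreg s _) (hTreg s _) (hTreg s _) (r s) i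
    refine hA.isClosedEmbedding hA.presents_configStructure (hA.presents_projectiveSpace 12)
      (P := P) (D := fun s => {z | z ∈ Set.univ ∧ z s ≠ 0}) (ρ := ρ)
      (e := fun s k z => P (ρ s z) k * z s + z k)
      (fun s => (A (Fin 5 × Fin 2)).reg_pentagonProduct (A (Fin 5 × Fin 2)).isOpen_univ
        hA.coord (r s)) hJ hD hρ ?_ ?_ ?_ ?_ ?_
    · rintro z y ⟨h, -⟩
      obtain ⟨s, hs⟩ := Function.ne_iff.1 h
      exact ⟨s, trivial, hs⟩
    · intro s z z' y h h' hz
      exact ⟨⟨trivial, (hinv h h' hz.2).1⟩, (hinv h h' hz.2).2⟩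
    · intro s w x h hs
      exact hsec h hs.2
    · intro s k
      exact (A (Fin 12)).reg_add (hD s) ((A (Fin 12)).reg_mul (hD s)
        ((A (Fin 12)).reg_pentagonProduct (hD s) (hρ s) (r k)) (hcoord s s)) (hcoord s k)
    · intro s z y h hz
      exact hrange h hz.2
  refine ⟨J, fun w hw => ?_, main isAffineGeometry_algebraicAffine,
    main isAffineGeometry_holomorphicAffine⟩
  obtain ⟨h, hx⟩ := hJ (w := w.1) ⟨w.2, hw, rfl⟩
  exact ⟨h, hx.symm⟩
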